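/- Let $F$ be an algebraically closed (commutative) field equipped with an absolute value, that is, a map $|\cdot|\colon F\to\mathbb R_{\geq 0}$ such that $|0|=0$, $|1|=1$, $|ab|=|a|\,|b|$ and $|a+b|\leq |a|+|b|$ for all $a,b\in F$. Let $\widehat F$ be the completion of $F$ with respect to the distance $(a,b)\mapsto |a-b|$, with its natural field structure. Then $\widehat F$ is algebraically closed. -/

import Mathlib

open Polynomial Filter Topology

/-! Roots vary continuously: a root of a monic polynomial lies near some root of any split monic
polynomial of the same degree with close coefficients. Approximate `f` by polynomials `g k` from the
dense algebraically closed field; nearby roots chain into a Cauchy sequence, whose limit is a root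
of `f`. -/

/-- The roots of monic polynomials with uniformly bounded coefficients are uniformly bounded. -/
theorem Polynomial.norm_le_of_isRoot_of_norm_coeff_le {L : Type*} [NormedField L] {g : L[X]}
    (hg : g.Monic) {C : ℝ} (hC : 0 ≤ C) (hcoeff : ∀ i < g.natDegree, ‖g.coeff i‖ ≤ C) {a : L}
    (ha : g.IsRoot a) : ‖a‖ ≤ C + 1 := by
  have h := (ha.norm_lt_cauchyBound hg.ne_zero).le
  have hb : g.cauchyBound ≤ C.toNNReal + 1 := by
    simp only [cauchyBound, hg.leadingCoeff, nnnorm_one, div_one]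
    gcongr
    refine Finset.sup_le fun i hi ↦ NNReal.le_toNNReal_of_coe_le ?_
    simpa using hcoeff i (Finset.mem_range.mp hi)
  have := NNReal.coe_le_coe.mpr (h.trans hb)
  simpa [hC] using this

/-- If a nonconstant polynomial over a complete normed field can be approximated coefficientwise by
split monic polynomials of the same degree, then it has a root. -/
theorem Polynomial.exists_eval_eq_zero_of_approx_splits {L : Type*} [NormedField L]
    [CompleteSpace L] {f : L[X]} (hn : f.natDegree ≠ 0)
    (happrox : ∀ ε : ℝ, 0 < ε → ∃ g : L[X], g.Monic ∧ g.Splits ∧ g.natDegree = f.natDegree ∧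
      ∀ i, ‖g.coeff i - f.coeff i‖ < ε) : ∃ a, f.eval a = 0 := by
  set n := f.natDegree
  set C : ℝ := ∑ i ∈ Finset.range n, ‖f.coeff i‖
  have hC : 0 ≤ C := Finset.sum_nonneg fun _ _ ↦ norm_nonneg _
  -- One `1` is for the error `ε k ≤ 1` in the coefficients, the other for the Cauchy bound.
  set M : ℝ := C + 1 + 1 with hM
  have hM1 : 1 ≤ M := by linarith
  have hM0 : 0 < M := by linarith
  -- Solves `((n + 1) * (2 * ε k)) ^ (1 / n) * M = (1 / 2) ^ k`, making root displacements summable;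
  -- the 2 covers the errors of both `g k` and `g (k + 1)`.
  set ε : ℕ → ℝ := fun k ↦ ((1 / 2) ^ k / M) ^ n / (2 * (n + 1)) with hεdef
  have hε : ∀ k, 0 < ε k := fun k ↦ by positivity
  have hεanti : ∀ k, ε (k + 1) ≤ ε k := fun k ↦ by
    simp only [hεdef]
    gcongr ((?_ / M) ^ n / _)
    exact pow_le_pow_of_le_one (by norm_num) (by norm_num) k.le_succ
  have hεle : ∀ k, ε k ≤ (1 / 2) ^ k := fun k ↦ by
    have h1 : (1 / 2 : ℝ) ^ k / M ≤ (1 / 2) ^ k := div_le_self (by positivity) hM1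
    have h2 : (1 / 2 : ℝ) ^ k ≤ 1 := pow_le_one₀ (by norm_num) (by norm_num)
    calc ε k ≤ ((1 / 2) ^ k / M) ^ n := div_le_self (by positivity) (by
          have : (0 : ℝ) ≤ n := n.cast_nonneg
          linarith)
      _ ≤ (1 / 2) ^ k / M := pow_le_of_le_one (by positivity) (h1.trans h2) hn
      _ ≤ (1 / 2) ^ k := h1
  choose g hgm hgs hgd hgc using fun k ↦ happrox (ε k) (hε k)
  have hbound : ∀ k a, (g k).eval a = 0 → ‖a‖ ≤ M := fun k a ha ↦ by
    refine norm_le_of_isRoot_of_norm_coeff_le (hgm k) (by linarith) (fun i hi ↦ ?_) ha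
    have h1 : ‖f.coeff i‖ ≤ C := Finset.single_le_sum (f := fun i ↦ ‖f.coeff i‖)
      (fun _ _ ↦ norm_nonneg _) (Finset.mem_range.mpr (hgd k ▸ hi))
    have h2 : ε k ≤ 1 := (hεle k).trans (pow_le_one₀ (by norm_num) (by norm_num))
    have h3 := norm_le_norm_add_norm_sub' ((g k).coeff i) (f.coeff i)
    linarith [hgc k i]
  have hstep : ∀ k a, (g k).eval a = 0 →
      ∃ b, (g (k + 1)).eval b = 0 ∧ ‖a - b‖ ≤ (1 / 2) ^ k := fun k a ha ↦ by
    obtain ⟨b, hb, hab⟩ := exists_roots_norm_sub_lt_of_norm_coeff_sub_lt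
      (ε := 2 * ε k) (by linarith [hε k]) ha (hgm k) (hgm (k + 1)) ((hgd _).trans (hgd k).symm)
      (fun i ↦ by
        have h := norm_sub_le_norm_sub_add_norm_sub ((g (k + 1)).coeff i) (f.coeff i)
          ((g k).coeff i)
        rw [norm_sub_rev (f.coeff i)] at h
        linarith [hgc k i, hgc (k + 1) i, hεanti k]) (hgs (k + 1))
    refine ⟨b, (mem_roots'.mp hb).2, hab.le.trans ?_⟩
    have hpow : ((n : ℝ) + 1) * (2 * ε k) = ((1 / 2) ^ k / M) ^ n := by
      simp only [hεdef]
      field_simp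
    rw [hgd k, hpow, Real.pow_rpow_inv_natCast (by positivity) hn]
    calc (1 / 2) ^ k / M * max ‖a‖ 1 ≤ (1 / 2) ^ k / M * M := by
          gcongr
          exact max_le (hbound k a ha) hM1
      _ = (1 / 2) ^ k := div_mul_cancel₀ _ hM0.ne'
  obtain ⟨a₀, ha₀⟩ := (hgs 0).exists_eval_eq_zero 
    (degree_ne_of_natDegree_ne (n := 0) ((hgd 0).trans_ne hn))
  choose! s hs hsd using hstep
  let b : ℕ → L := fun k ↦ Nat.rec a₀ s k
  have hb : ∀ k, (g k).eval (b k) = 0 := fun k ↦ by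
    induction k with
    | zero => exact ha₀
    | succ k ih => exact hs k _ ih
  have hcauchy : CauchySeq b := cauchySeq_of_le_geometric (1 / 2) 1 (by norm_num) fun k ↦ by
    rw [dist_eq_norm, one_mul]
    exact hsd k _ (hb k)
  obtain ⟨a, ha⟩ := cauchySeq_tendsto_of_complete hcauchy
  have hε0 : Tendsto ε atTop (𝓝 0) := squeeze_zero (fun k ↦ (hε k).le) hεle
    (tendsto_pow_atTop_nhds_zero_of_lt_one (by norm_num) (by norm_num))
  have hcoeff : ∀ i, Tendsto (fun k ↦ (g k).coeff i) atTop (𝓝 (f.coeff i)) := fun i ↦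
    tendsto_iff_norm_sub_tendsto_zero.mpr
      (squeeze_zero (fun _ ↦ norm_nonneg _) (fun k ↦ (hgc k i).le) hε0)
  have hlim : Tendsto (fun k ↦ (g k).eval (b k)) atTop (𝓝 (f.eval a)) := by
    simp only [eval_eq_sum_range, hgd]
    exact tendsto_finsetSum _ fun i _ ↦ (hcoeff i).mul (ha.pow i)
  refine ⟨a, tendsto_nhds_unique hlim ?_⟩
  simp only [hb]
  exact tendsto_const_nhds

/-- A complete normed field with a dense algebraically closed subfield is algebraically closed. -/
theorem IsAlgClosed.of_denseRange_of_complete {K L : Type*} [Field K] [NormedField L]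
    [CompleteSpace L] [Algebra K L] (hd : DenseRange (algebraMap K L)) [IsAlgClosed K] :
    IsAlgClosed L := by
  refine IsAlgClosed.of_exists_root _ fun f hf hirr ↦
    Polynomial.exists_eval_eq_zero_of_approx_splits hirr.natDegree_pos.ne' fun ε hε ↦ ?_
  obtain ⟨g, hgm, hgd, hgc⟩ :=
    exists_monic_and_natDegree_eq_and_norm_map_algebraMap_coeff_sub_lt hd hf hε
  exact ⟨g.map (algebraMap K L), hgm.map _, (IsAlgClosed.splits g).map _,
    (g.natDegree_map _).trans hgd.symm, hgc⟩

theorem mainTheorem6 {F : Type*} [Field F] [IsAlgClosed F] (v : AbsoluteValue F ℝ) :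
    IsAlgClosed v.Completion := by
  have : IsAlgClosed (WithAbs v) := IsAlgClosed.of_ringEquiv F _ (WithAbs.equiv v).symm
  exact IsAlgClosed.of_denseRange_of_complete (K := WithAbs v)
    UniformSpace.Completion.denseRange_coe
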